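/- Fix an integer $b\ge 2$ and let $T_r=(V_r,E_r)$ be the complete rooted $b$-ary tree with root at level $0$ and leaves at level $r$; put $n_r=|V_r|$. For $\beta>0$ consider the Ising measure on $\{-1,+1\}^{V_r}$, $\pi(\sigma)\propto\prod_{vw\in E_r}e^{\beta\sigma(v)\sigma(w)}$. For a probability distribution $\rho$ on $V_r$, let $P_\rho$ be the transition matrix of the discrete-time Glauber dynamics with rates $\rho$: at each step a vertex $v$ is picked with probability $\rho(v)$ and its spin is set to $a\in\{-1,+1\}$ with probability $\prod_{w\sim v}e^{\beta a\sigma(w)}\big/\sum_{a'=\pm1}\prod_{w\sim v}e^{\beta a'\sigma(w)}$. Let $\tau_2(P)=1/(1-\lambda_2(P))$, where $\lambda_1\ge\lambda_2\ge\cdots$ are the eigenvalues of $P$ counted with multiplicity (and $\tau_2(P)=\infty$ if $\lambda_2(P)=1$). List the vertices of $T_r$ in the order of a depth-first search from the root. For $v\in V_r$ let $\xi(v)$ be the number of edges of $T_r$ joining a vertex that does not come after $v$ to a vertex that comes after $v$, let $\Delta$ be the maximum degree of $T_r$, and put $B_v=n_r^2\,e^{(4\xi(v)+2\Delta)\beta}$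 and $\tilde\rho(v)=B_v/\sum_{u}B_u$. Then there is $\beta_0=\beta_0(b)>0$ such that for every fixed $\beta\ge\beta_0$, as $r\to\infty$, $$\tau_2(P_{\tilde\rho})=O\!\left(n_r\,e^{4(b-1)\beta r}\right),$$ and the same bound holds for $\tau_2(P_{\rho^\star})$, whenever $\rho^\star$ is a probability distribution on $V_r$ that minimizes $\rho\mapsto\tau_2(P_\rho)$. In contrast, for the uniform rates $U$ and every fixed $\beta>0$ one has $$\tau_2(P_U)=O\!\left(n_r^2\,e^{4(b-1)\beta r}\right).$$ The implied constants depend only on $b$ and $\beta$. -/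

import Mathlib

noncomputable section

/-! ### Relaxation time of a reversible chain -/

/-- The second largest eigenvalue `λ₂` of a real square matrix: the eigenvalues, counted with
multiplicity (all of them are real for a reversible transition matrix), are listed in decreasing
order `λ₁ ≥ λ₂ ≥ ⋯` and the second one is read off. -/
def secondEigenvalue {S : Type*} [Fintype S] [DecidableEq S] (P : Matrix S S ℝ) : ℝ :=
  (P.charpoly.roots.sort (· ≥ ·)).getD 1 0

/-- The relaxation time `τ₂ = 1 / (1 - λ₂)`, which is `∞` when `λ₂ = 1`. -/
def relaxationTime {S : Type*} [Fintype S] [DecidableEq S] (P : Matrix S S ℝ) : ENNReal :=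
  (ENNReal.ofReal (1 - secondEigenvalue P))⁻¹

/-! ### The Ising model and its Glauber dynamics with update rates -/

section Ising

variable {V : Type*} [Fintype V] [DecidableEq V] (G : SimpleGraph V) [DecidableRel G.Adj]

/-- A spin, an element of `{-1, +1}`, as a real number. -/
def spin (a : ℤˣ) : ℝ := ((a : ℤ) : ℝ)

/-- The product `∏_{vw ∈ E} exp (β σ(v) σ(w))` over the undirected edges. -/
def isingWeight (β : ℝ) (σ : V → ℤˣ) : ℝ :=
  ∏ e ∈ G.edgeFinset, Real.exp (β * spin (e.map σ).mul)

/-- The Ising measure `π(σ)`, normalized by the partition function. -/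
def isingMeasure (β : ℝ) (σ : V → ℤˣ) : ℝ :=
  isingWeight G β σ / ∑ τ : V → ℤˣ, isingWeight G β τ

/-- The unnormalized weight `∏_{w ∼ v} exp (β a σ(w))` of the value `a` at the vertex `v`. -/
def localWeight (β : ℝ) (σ : V → ℤˣ) (v : V) (a : ℤˣ) : ℝ :=
  ∏ w ∈ G.neighborFinset v, Real.exp (β * (spin a * spin (σ w)))

/-- The probability `K(σ, σ_v^a)` that an update at the vertex `v` produces the value `a`. -/
def updateProb (β : ℝ) (σ : V → ℤˣ) (v : V) (a : ℤˣ) : ℝ :=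
  localWeight G β σ v a / ∑ a' : ℤˣ, localWeight G β σ v a'

/-- The transition matrix `P_ρ` of the Glauber dynamics with rates `ρ`: a vertex `v` is picked
with probability `ρ v`, then its spin is updated according to `updateProb`. -/
def glauber (β : ℝ) (ρ : V → ℝ) : Matrix (V → ℤˣ) (V → ℤˣ) ℝ :=
  Matrix.of fun σ σ' =>
    ∑ v : V, ∑ a : ℤˣ, if σ' = Function.update σ v a then ρ v * updateProb G β σ v a else 0

/-- Splitting off the edges at `v`. -/
theorem isingWeight_update (β : ℝ) (σ : V → ℤˣ) (v : V) (a : ℤˣ) :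
    isingWeight G β (Function.update σ v a) =
      localWeight G β σ v a *
        ∏ e ∈ G.edgeFinset \ G.incidenceFinset v, Real.exp (β * spin (e.map σ).mul) := by
  unfold isingWeight localWeight
  rw [← Finset.prod_sdiff (G.incidenceFinset_subset v), mul_comm]
  congr 1
  · symm
    refine Finset.prod_bij (fun w _ => s(v, w)) ?_ ?_ ?_ ?_
    · intro w hw
      simpa [SimpleGraph.mem_incidenceFinset, SimpleGraph.mem_incidenceSet] using hw
    · intro w _ w' _ h
      exact Sym2.congr_right.1 h
    · intro e he
      rw [SimpleGraph.mem_incidenceFinset] at he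
      induction e with
      | h x y =>
        obtain ⟨hxy, hv⟩ := he
        rcases Sym2.mem_iff.1 hv with rfl | rfl
        · exact ⟨y, by simpa using hxy, rfl⟩
        · exact ⟨x, by simpa using hxy.symm, Sym2.eq_swap⟩
    · intro w hw
      have hw' : w ≠ v := by
        rintro rfl
        simp at hw
      simp [hw', spin]
  · refine Finset.prod_congr rfl fun e he => ?_
    rw [Finset.mem_sdiff, SimpleGraph.mem_incidenceFinset, SimpleGraph.mem_edgeFinset] at he
    obtain ⟨h1, h2⟩ := he
    have hv : v ∉ e := fun h => h2 ⟨h1, h⟩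
    induction e with
    | h x y =>
      simp only [Sym2.mem_iff, not_or] at hv
      simp [Ne.symm hv.1, Ne.symm hv.2]

/-- The local weight at `v` does not depend on the spin at `v`. -/
theorem localWeight_update (β : ℝ) (σ : V → ℤˣ) (v : V) (a c : ℤˣ) :
    localWeight G β (Function.update σ v a) v c = localWeight G β σ v c := by
  refine Finset.prod_congr rfl fun w hw => ?_
  have hw' : w ≠ v := by
    rintro rfl
    simp at hw
  simp [hw']

/-- The Glauber dynamics is reversible with respect to the Ising measure. -/
theorem isingMeasure_mul_glauber (β : ℝ) (ρ : V → ℝ) (σ σ' : V → ℤˣ) :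
    isingMeasure G β σ * glauber G β ρ σ σ' = isingMeasure G β σ' * glauber G β ρ σ' σ := by
  simp only [glauber, Matrix.of_apply, Finset.mul_sum]
  refine Finset.sum_congr rfl fun v _ => ?_
  by_cases h : ∃ a, σ' = Function.update σ v a
  · obtain ⟨a, rfl⟩ := h
    have h1 : ∀ c, (Function.update σ v a = Function.update σ v c) ↔ a = c := fun c =>
      (Function.update_injective σ v).eq_iff
    have h2 : ∀ c, (σ = Function.update (Function.update σ v a) v c) ↔ σ v = c := fun c => by
      rw [Function.update_idem, eq_comm, Function.update_eq_iff]
      simp [eq_comm]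
    simp only [h1, h2, mul_ite, mul_zero, Finset.sum_ite_eq, Finset.mem_univ, if_true]
    unfold isingMeasure updateProb
    simp only [localWeight_update]
    have h3 := isingWeight_update G β σ v (σ v)
    rw [Function.update_eq_self] at h3
    rw [isingWeight_update, h3]
    ring
  · have h' : ¬ ∃ a, σ = Function.update σ' v a := by
      rintro ⟨a, rfl⟩
      exact h ⟨σ' v, by simp⟩
    push Not at h h'
    simp [h, h']

/-- The uniform rates `U`. -/
def uniformRates (V : Type*) [Fintype V] : V → ℝ := fun _ => 1 / (Fintype.card V : ℝ)

/-- `ρ` is a probability distribution on the vertices which minimizes the relaxation time of the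
Glauber dynamics among all such distributions. -/
def IsOptimalRates (β : ℝ) (ρ : V → ℝ) : Prop :=
  ρ ∈ stdSimplex ℝ V ∧
    ∀ ρ' ∈ stdSimplex ℝ V, relaxationTime (glauber G β ρ) ≤ relaxationTime (glauber G β ρ')

/-- The width of the vertex `v` in the ordering of the vertices given by an injective labelling `I`
with labels in a linearly ordered set: the number of edges from `{x | I x ≤ I v}` to
`{y | I v < I y}`. -/
def vertexWidth {L : Type*} [LinearOrder L] (I : V → L) (v : V) : ℕ :=
  ((Finset.univ : Finset (V × V)).filter
    fun p => I p.1 ≤ I v ∧ I v < I p.2 ∧ G.Adj p.1 p.2).card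

/-- The bound `B_v = |V|² exp ((4 ξ(v) + 2 Δ) β)`, where `ξ(v)` is the width of `v` in the
ordering `I` and `Δ` is the maximum degree. -/
def widthBound {L : Type*} [LinearOrder L] (β : ℝ) (I : V → L) (v : V) : ℝ :=
  (Fintype.card V : ℝ) ^ 2 *
    Real.exp ((4 * (vertexWidth G I v : ℝ) + 2 * (G.maxDegree : ℝ)) * β)

/-- The rates `B_v / ∑ᵤ B_u` attached to the ordering `I`. -/
def widthRates {L : Type*} [LinearOrder L] (β : ℝ) (I : V → L) (v : V) : ℝ :=
  widthBound G β I v / ∑ u : V, widthBound G β I u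

end Ising

/-! ### The complete rooted `b`-ary tree -/

/-- The vertices of the complete rooted `b`-ary tree with levels `0, …, r`: a vertex on level `l`
is the word of length `l` over `{0, …, b - 1}` listing the child taken at each step from the root
(the empty word). -/
abbrev TreeVertex (b r : ℕ) : Type := {x : List (Fin b) // x.length ≤ r}

instance (b r : ℕ) : Fintype (TreeVertex b r) :=
  @Fintype.ofFinite _ (List.finite_length_le (Fin b) r).to_subtype

/-- The complete rooted `b`-ary tree: every vertex below level `r` is joined to its `b` children,
obtained by appending one letter. -/
def completeTree (b r : ℕ) : SimpleGraph (TreeVertex b r) where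
  Adj x y := (∃ a : Fin b, y.1 = x.1 ++ [a]) ∨ ∃ a : Fin b, x.1 = y.1 ++ [a]
  symm := ⟨fun _ _ h => h.symm⟩
  loopless := ⟨fun x h => by
    rcases h with ⟨a, h⟩ | ⟨a, h⟩ <;> simpa using congrArg List.length h⟩

instance (b r : ℕ) : DecidableRel (completeTree b r).Adj := Classical.decRel _

/-- The order in which a depth-first search from the root (with the children of each vertex taken
in their natural order) visits the vertices: it is the lexicographic order of the words, in which
a word precedes its proper extensions. -/
def dfsOrder (b r : ℕ) : TreeVertex b r → List (Fin b) := Subtype.val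

/-- The rates `B_v / ∑ᵤ B_u` on the tree, for the widths in the depth-first search order. -/
def dfsRates (b r : ℕ) (β : ℝ) : TreeVertex b r → ℝ :=
  widthRates (completeTree b r) β (dfsOrder b r)

/-- The number `n_r` of vertices of the tree. -/
def treeCard (b r : ℕ) : ℕ := Fintype.card (TreeVertex b r)

end

/-! A canonical-path argument along the depth-first order. To compare `f σ` and `f η` for
independent samples, the spins of `σ` are replaced by those of `η` one vertex at a time. With
weighted Cauchy–Schwarz the variance is bounded by flip differences at the hybrids that are `η` up
to `v` and `σ` afterwards, so all depends on how much likelier a hybrid is than an Ising sample.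

The obvious swap of `σ` and `η` beyond `v` disturbs both configurations on each cut edge. In the
tree, however, every component beyond the cut hangs from a single earlier vertex, so flipping whole
components lets the companion configuration keep its products on the cut edges. Only the hybrid
pays, at most `exp (2β)` per cut edge (`cutExchange`, `isingWeight_mul_isingWeight_le`,
`sum_sum_piecewise_le`). Hence `relaxationTime_glauber_le`: up to a degree factor, `τ₂ ≤ ∑ exp
(2βξ(v)) / ρ(v)`.

For the width rates, proportional to `exp (4βξ(v))`, this sum is `(∑ exp (4βξ)) (∑ exp (-2βξ))`. Up
to an additive `b`, the width is a sum of independent contributions of the letters of `v`, so both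
sums are geometric series (`sum_pow_branchCount`). For large `β` the first is near its dominant term
`exp (4(b-1)βr)`, and the remaining exponential factors stay below `b ^ r ≤ n_r`. For uniform rates
the pointwise bound on `ξ` suffices. -/

noncomputable section

/-! ### Spectral gap of a reversible matrix -/

section Spectral

variable {S : Type*} [Fintype S] [DecidableEq S]

/-- The symmetrization `√π P √π⁻¹` of a matrix. -/
def symmetrization (π : S → ℝ) (P : Matrix S S ℝ) : Matrix S S ℝ :=
  Matrix.diagonal (fun i => √(π i)) * P * Matrix.diagonal (fun i => (√(π i))⁻¹)

theorem symmetrization_apply (π : S → ℝ) (P : Matrix S S ℝ) (i j : S) :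
    symmetrization π P i j = √(π i) * P i j * (√(π j))⁻¹ := by
  simp [symmetrization]

theorem symmetrization_isHermitian {π : S → ℝ} (hπ : ∀ i, 0 < π i) {P : Matrix S S ℝ}
    (hrev : ∀ i j, π i * P i j = π j * P j i) : (symmetrization π P).IsHermitian := by
  ext i j
  have hi := Real.sqrt_pos.2 (hπ i)
  have hj := Real.sqrt_pos.2 (hπ j)
  simp only [Matrix.conjTranspose_apply, symmetrization_apply, star_trivial]
  have h := hrev i j
  rw [← Real.mul_self_sqrt (hπ i).le, ← Real.mul_self_sqrt (hπ j).le] at h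
  field_simp
  linarith

/-- Symmetrization is a similarity, so the spectral theorem for Hermitian matrices gives access to
the eigenvalues of `P`. -/
theorem charpoly_symmetrization {π : S → ℝ} (hπ : ∀ i, 0 < π i) (P : Matrix S S ℝ) :
    (symmetrization π P).charpoly = P.charpoly := by
  unfold symmetrization
  rw [Matrix.charpoly_mul_comm, ← Matrix.mul_assoc, Matrix.diagonal_mul_diagonal]
  have : (fun i => (√(π i))⁻¹ * √(π i)) = fun _ => (1 : ℝ) := by
    funext i
    exact inv_mul_cancel₀ (Real.sqrt_pos.2 (hπ i)).ne'
  rw [this, Matrix.diagonal_one, Matrix.one_mul]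

/-- A Poincaré inequality bounds the second eigenvalue of a reversible matrix. -/
theorem secondEigenvalue_le_of_poincare [Nontrivial S] {π : S → ℝ} (hπ : ∀ i, 0 < π i)
    {P : Matrix S S ℝ} (hrev : ∀ i j, π i * P i j = π j * P j i) {γ : ℝ}
    (hgap : ∀ f : S → ℝ, ∑ i, π i * f i = 0 →
      γ * ∑ i, π i * f i ^ 2 ≤ ∑ i, π i * (f i * (f i - ∑ j, P i j * f j))) :
    secondEigenvalue P ≤ 1 - γ := by
  have hA := symmetrization_isHermitian hπ hrev
  have hcard : 1 < Fintype.card S := Fintype.one_lt_card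
  have hsort := hA.sort_roots_charpoly_eq_eigenvalues₀
  rw [charpoly_symmetrization hπ] at hsort
  -- With at least two states the list of roots has an entry at index 1, so the default value 0 is
  -- never read.
  have hsec : secondEigenvalue P = hA.eigenvalues₀ ⟨1, hcard⟩ := by
    have : P.charpoly.roots.sort (· ≥ ·) = List.ofFn hA.eigenvalues₀ := by
      rw [← hsort]
      congr 1
      exact (Multiset.map_id' _).symm
    rw [secondEigenvalue, this, List.getD_eq_getElem _ _ (by simpa using hcard)]
    simp
  set e := Fintype.equivOfCardEq (Fintype.card_fin (Fintype.card S)) with he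
  set p := e ⟨0, by omega⟩ with hp
  set q := e ⟨1, hcard⟩ with hq
  have hpq : p ≠ q := fun h => by simpa using e.injective h
  have hlq : hA.eigenvalues q = hA.eigenvalues₀ ⟨1, hcard⟩ := by
    simp [Matrix.IsHermitian.eigenvalues, hq, he]
  have hlp : hA.eigenvalues₀ ⟨1, hcard⟩ ≤ hA.eigenvalues p := by
    simp only [Matrix.IsHermitian.eigenvalues, hp, he, Equiv.symm_apply_apply]
    exact hA.eigenvalues₀_antitone (by simp)
  rw [hsec]
  set u := hA.eigenvectorBasis p with hu
  set v := hA.eigenvectorBasis q with hv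
  have hs : ∀ i, 0 < √(π i) := fun i => Real.sqrt_pos.2 (hπ i)
  have hss : ∀ i, √(π i) * √(π i) = π i := fun i => Real.mul_self_sqrt (hπ i).le
  have horth : ∀ k l : S, ∑ i, hA.eigenvectorBasis k i * hA.eigenvectorBasis l i =
      if k = l then 1 else 0 := fun k l => by
    have := orthonormal_iff_ite.1 hA.eigenvectorBasis.orthonormal l k
    rw [PiLp.inner_apply] at this
    simpa [eq_comm] using this
  have huu : ∑ i, u i * u i = 1 := by simpa using horth p p
  have hvv : ∑ i, v i * v i = 1 := by simpa using horth q q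
  have huv : ∑ i, u i * v i = 0 := by simpa [hpq] using horth p q
  have heig : ∀ k i, ∑ j, P i j * (hA.eigenvectorBasis k j / √(π j)) =
      hA.eigenvalues k * (hA.eigenvectorBasis k i / √(π i)) := fun k i => by
    have := congrFun (hA.mulVec_eigenvectorBasis k) i
    simp only [Matrix.mulVec, dotProduct, symmetrization_apply, Pi.smul_apply, smul_eq_mul] at this
    rw [← mul_div_assoc, ← this, Finset.sum_div]
    refine Finset.sum_congr rfl fun j _ => ?_
    have := (hs i).ne'
    have := (hs j).ne'
    field_simp
  -- The top two eigenfunctions span a plane, and mean zero is one linear condition, so some nonzero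
  -- combination satisfies it. Its Rayleigh quotient bounds the gap without identifying the top
  -- eigenvalue.
  obtain ⟨a, b, hab, h0⟩ : ∃ a b : ℝ, 0 < a ^ 2 + b ^ 2 ∧
      a * ∑ i, √(π i) * u i + b * ∑ i, √(π i) * v i = 0 := by
    by_cases h : ∑ i, √(π i) * u i = 0
    · exact ⟨1, 0, by norm_num, by simp [h]⟩
    · refine ⟨∑ i, √(π i) * v i, -∑ i, √(π i) * u i, ?_, by ring⟩
      have : 0 < (∑ i, √(π i) * u i) ^ 2 := by positivity
      rw [neg_sq]
      positivity
  have key := hgap (fun i => a * (u i / √(π i)) + b * (v i / √(π i))) (by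
    rw [← h0, Finset.mul_sum, Finset.mul_sum, ← Finset.sum_add_distrib]
    refine Finset.sum_congr rfl fun i _ => ?_
    have h1 := (hs i).ne'
    have h2 := (hss i).symm
    generalize √(π i) = s at h1 h2 ⊢
    rw [h2]
    field_simp)
  have hnorm : ∑ i, π i * (a * (u i / √(π i)) + b * (v i / √(π i))) ^ 2 = a ^ 2 + b ^ 2 := by
    calc _ = a ^ 2 * ∑ i, u i * u i + b ^ 2 * ∑ i, v i * v i + 2 * a * b * ∑ i, u i * v i := by
          simp only [Finset.mul_sum, ← Finset.sum_add_distrib]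
          refine Finset.sum_congr rfl fun i _ => ?_
          have h1 := (hs i).ne'
          have h2 := (hss i).symm
          generalize √(π i) = s at h1 h2 ⊢
          rw [h2]
          field_simp
          ring
      _ = _ := by rw [huu, hvv, huv]; ring
  have hPf : ∀ i, ∑ j, P i j * (a * (u j / √(π j)) + b * (v j / √(π j))) =
      a * (hA.eigenvalues p * (u i / √(π i))) + b * (hA.eigenvalues q * (v i / √(π i))) := by
    intro i
    rw [← heig p i, ← heig q i, Finset.mul_sum, Finset.mul_sum, ← Finset.sum_add_distrib]
    exact Finset.sum_congr rfl fun j _ => by ring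
  have henergy : ∑ i, π i * ((a * (u i / √(π i)) + b * (v i / √(π i))) *
      ((a * (u i / √(π i)) + b * (v i / √(π i))) -
        ∑ j, P i j * (a * (u j / √(π j)) + b * (v j / √(π j))))) =
      a ^ 2 * (1 - hA.eigenvalues p) + b ^ 2 * (1 - hA.eigenvalues q) := by
    calc _ = a ^ 2 * (1 - hA.eigenvalues p) * ∑ i, u i * u i +
            b ^ 2 * (1 - hA.eigenvalues q) * ∑ i, v i * v i +
            a * b * (2 - hA.eigenvalues p - hA.eigenvalues q) * ∑ i, u i * v i := by
          simp only [Finset.mul_sum, ← Finset.sum_add_distrib, hPf]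
          refine Finset.sum_congr rfl fun i _ => ?_
          have h1 := (hs i).ne'
          have h2 := (hss i).symm
          generalize √(π i) = s at h1 h2 ⊢
          rw [h2]
          field_simp
          ring
      _ = _ := by rw [huu, hvv, huv]; ring
  rw [hnorm, henergy, hlq] at key
  have : γ * (a ^ 2 + b ^ 2) ≤ (1 - hA.eigenvalues₀ ⟨1, hcard⟩) * (a ^ 2 + b ^ 2) := by
    nlinarith [mul_le_mul_of_nonneg_left hlp (sq_nonneg a)]
  have := le_of_mul_le_mul_right this hab
  linarith

theorem relaxationTime_le_of_secondEigenvalue_le {P : Matrix S S ℝ} {B : ℝ} (hB : 0 < B)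
    (h : secondEigenvalue P ≤ 1 - B⁻¹) : relaxationTime P ≤ ENNReal.ofReal B := by
  rw [relaxationTime, ENNReal.inv_le_iff_inv_le, ← ENNReal.ofReal_inv_of_pos hB]
  exact ENNReal.ofReal_le_ofReal (by linarith)

omit [DecidableEq S] in
/-- The Dirichlet form of a reversible stochastic matrix. -/
theorem sum_mul_sub_eq_half_sum_sq {π : S → ℝ} {P : Matrix S S ℝ}
    (hrev : ∀ i j, π i * P i j = π j * P j i) (hrow : ∀ i, ∑ j, P i j = 1) (f : S → ℝ) :
    ∑ i, π i * (f i * (f i - ∑ j, P i j * f j)) =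
      (∑ i, π i * ∑ j, P i j * (f i - f j) ^ 2) / 2 := by
  have h1 : ∑ i, π i * ∑ j, P i j * (f i - f j) ^ 2 =
      ∑ i, ∑ j, (π i * P i j) * f i ^ 2 + ∑ i, ∑ j, (π i * P i j) * f j ^ 2
        - 2 * ∑ i, ∑ j, (π i * P i j) * (f i * f j) := by
    simp only [Finset.mul_sum, ← Finset.sum_add_distrib, ← Finset.sum_sub_distrib]
    exact Finset.sum_congr rfl fun i _ => Finset.sum_congr rfl fun j _ => by ring
  have h2 : ∑ i, ∑ j, (π i * P i j) * f j ^ 2 = ∑ i, ∑ j, (π i * P i j) * f i ^ 2 := by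
    rw [Finset.sum_comm]
    exact Finset.sum_congr rfl fun i _ => Finset.sum_congr rfl fun j _ => by rw [hrev j i]
  have h3 : ∑ i, ∑ j, (π i * P i j) * f i ^ 2 = ∑ i, π i * (f i * f i) := by
    refine Finset.sum_congr rfl fun i _ => ?_
    rw [← Finset.sum_mul, ← Finset.mul_sum, hrow]
    ring
  have h4 : ∑ i, ∑ j, (π i * P i j) * (f i * f j) = ∑ i, π i * (f i * ∑ j, P i j * f j) := by
    simp only [Finset.mul_sum]
    exact Finset.sum_congr rfl fun i _ => Finset.sum_congr rfl fun j _ => by ring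
  rw [h1, h2, h3, h4]
  simp only [mul_sub, Finset.sum_sub_distrib]
  ring

omit [DecidableEq S] in
/-- The variance as a double sum. -/
theorem sum_mul_sq_eq_half_sum_sq {π : S → ℝ} (hsum : ∑ i, π i = 1) {f : S → ℝ}
    (hf : ∑ i, π i * f i = 0) :
    ∑ i, π i * f i ^ 2 = (∑ i, ∑ j, π i * π j * (f j - f i) ^ 2) / 2 := by
  have h1 : ∑ i, ∑ j, π i * π j * (f j - f i) ^ 2 =
      (∑ i, π i) * ∑ j, π j * f j ^ 2 + (∑ i, π i * f i ^ 2) * ∑ j, π j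
        - 2 * ((∑ i, π i * f i) * ∑ j, π j * f j) := by
    rw [Finset.sum_mul_sum, Finset.sum_mul_sum, Finset.sum_mul_sum]
    simp only [Finset.mul_sum, ← Finset.sum_add_distrib, ← Finset.sum_sub_distrib]
    exact Finset.sum_congr rfl fun i _ => Finset.sum_congr rfl fun j _ => by ring
  rw [h1, hsum, hf]
  ring

end Spectral

/-! ### Telescoping along an ordering -/

section Interpolation

variable {V : Type*} [Fintype V] [DecidableEq V] {L : Type*} [LinearOrder L]

/-- The vertices that do not come after `v`. -/
def initialSegment (I : V → L) (v : V) : Finset V := Finset.univ.filter fun x => I x ≤ I v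

omit [DecidableEq V] in
theorem mem_initialSegment {I : V → L} {v x : V} : x ∈ initialSegment I v ↔ I x ≤ I v := by
  simp [initialSegment]

/-- Telescoping, by induction over finite sets to which a vertex of largest label is added: the
filters of the earlier vertices do not see the new one. -/
theorem piecewise_sub_eq_sum {I : V → L} (hI : Function.Injective I) {α : Type*}
    (f : (V → α) → ℝ) (σ η : V → α) :
    f η - f σ = ∑ v, (f ((initialSegment I v).piecewise η σ) -
      f ((Finset.univ.filter fun x => I x < I v).piecewise η σ)) := by
  have key : ∀ s : Finset V, f (s.piecewise η σ) - f σ =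
      ∑ v ∈ s, (f ((s.filter fun x => I x ≤ I v).piecewise η σ) -
        f ((s.filter fun x => I x < I v).piecewise η σ)) := by
    intro s
    refine Finset.induction_on_max_value I s (by simp) fun a s ha hmax ih => ?_
    have hlt : ∀ x ∈ s, I x < I a := fun x hx =>
      lt_of_le_of_ne (hmax x hx) fun h => ha (hI h ▸ hx)
    rw [Finset.sum_insert ha]
    have e1 : (insert a s).filter (fun x => I x ≤ I a) = insert a s :=
      Finset.filter_true_of_mem fun x hx => by
        rcases Finset.mem_insert.1 hx with rfl | hx
        exacts [le_rfl, hmax x hx]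
    have e2 : (insert a s).filter (fun x => I x < I a) = s := by
      rw [Finset.filter_insert, if_neg (lt_irrefl _), Finset.filter_true_of_mem hlt]
    have e3 : ∀ v ∈ s, (insert a s).filter (fun x => I x ≤ I v) = s.filter fun x => I x ≤ I v :=
      fun v hv => by rw [Finset.filter_insert, if_neg (hlt v hv).not_ge]
    have e4 : ∀ v ∈ s, (insert a s).filter (fun x => I x < I v) = s.filter fun x => I x < I v :=
      fun v hv => by rw [Finset.filter_insert, if_neg (hlt v hv).not_gt]
    rw [e1, e2, Finset.sum_congr rfl fun v hv => by rw [e3 v hv, e4 v hv], ← ih]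
    ring
  have h := key Finset.univ
  rwa [Finset.piecewise_univ] at h

/-- The difference of a function of the spins across a spin flip at `v`. -/
def flipDiff (f : (V → ℤˣ) → ℝ) (v : V) (σ : V → ℤˣ) : ℝ :=
  f (Function.update σ v 1) - f (Function.update σ v (-1))

omit [Fintype V] in
theorem sq_sub_update_le_sq_flipDiff (f : (V → ℤˣ) → ℝ) (v : V) (σ : V → ℤˣ) (a : ℤˣ) :
    (f σ - f (Function.update σ v a)) ^ 2 ≤ flipDiff f v σ ^ 2 := by
  obtain ⟨c, hc⟩ : ∃ c, σ v = c := ⟨_, rfl⟩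
  have hσ : σ = Function.update σ v c := by rw [← hc, Function.update_eq_self]
  have h : (f (Function.update σ v c) - f (Function.update σ v a)) ^ 2 ≤ flipDiff f v σ ^ 2 := by
    unfold flipDiff
    rcases Int.units_eq_one_or c with rfl | rfl <;> rcases Int.units_eq_one_or a with rfl | rfl
    · simp; positivity
    · exact le_rfl
    · exact (sub_sq_comm _ _).le
    · simp; positivity
  rwa [← hσ] at h

omit [Fintype V] in
theorem sq_flipDiff_eq (f : (V → ℤˣ) → ℝ) (v : V) (σ : V → ℤˣ) :
    flipDiff f v σ ^ 2 = (f σ - f (Function.update σ v (-σ v))) ^ 2 := by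
  obtain ⟨c, hc⟩ : ∃ c, σ v = c := ⟨_, rfl⟩
  have hσ : σ = Function.update σ v c := by rw [← hc, Function.update_eq_self]
  have h : flipDiff f v σ ^ 2 =
      (f (Function.update σ v c) - f (Function.update σ v (-c))) ^ 2 := by
    unfold flipDiff
    rcases Int.units_eq_one_or c with rfl | rfl
    · rfl
    · rw [neg_neg, sub_sq_comm]
  rwa [← hσ, ← hc] at h

theorem piecewise_lt_eq_update {I : V → L} (hI : Function.Injective I) {α : Type*}
    (σ η : V → α) (v : V) :
    (Finset.univ.filter fun x => I x < I v).piecewise η σ =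
      Function.update ((initialSegment I v).piecewise η σ) v (σ v) := by
  funext x
  rcases eq_or_ne x v with rfl | hx
  · simp
  · have : I x ≠ I v := fun h => hx (hI h)
    simp [Finset.piecewise, hx, mem_initialSegment, le_iff_lt_or_eq, this]

/-- Cauchy–Schwarz with free weights, since consecutive hybrids differ at most in the spin at `v`.
-/
theorem sq_sub_le_sum_mul_sum {I : V → L} (hI : Function.Injective I) (f : (V → ℤˣ) → ℝ)
    {w : V → ℝ} (hw : ∀ v, 0 < w v) (σ η : V → ℤˣ) :
    (f η - f σ) ^ 2 ≤
      (∑ v, w v) * ∑ v, flipDiff f v ((initialSegment I v).piecewise η σ) ^ 2 / w v := by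
  rw [piecewise_sub_eq_sum hI]
  refine (Finset.sum_sq_le_sum_mul_sum_of_sq_le_mul Finset.univ (f := w)
    (g := fun v => (f ((initialSegment I v).piecewise η σ) -
      f ((Finset.univ.filter fun x => I x < I v).piecewise η σ)) ^ 2 / w v)
    (fun v _ => (hw v).le) (fun v _ => div_nonneg (sq_nonneg _) (hw v).le)
    fun v _ => (mul_div_cancel₀ _ (hw v).ne').ge).trans ?_
  refine mul_le_mul_of_nonneg_left (Finset.sum_le_sum fun v _ => ?_)
    (Finset.sum_nonneg fun v _ => (hw v).le)
  rw [piecewise_lt_eq_update hI]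
  exact div_le_div_of_nonneg_right (sq_sub_update_le_sq_flipDiff f v _ _) (hw v).le

end Interpolation

/-! ### Comparison of Ising weights across a cut -/

section Cut

variable {V : Type*}

/-- A map onto `A` that is the identity on `A` and is constant on every component of the graph
obtained by deleting the edges inside `A`. Such a map exists exactly if different vertices of `A`
are not joined through the complement of `A`. -/
structure IsCutRetraction (G : SimpleGraph V) (A : Finset V) (t : V → V) : Prop where
  map_mem : ∀ x, t x ∈ A
  map_eq : ∀ x ∈ A, t x = x
  map_adj : ∀ x y, G.Adj x y → y ∉ A → t x = t y

theorem spin_mul (a c : ℤˣ) : spin (a * c) = spin a * spin c := by simp [spin]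

theorem abs_spin (a : ℤˣ) : |spin a| = 1 := by
  rcases Int.units_eq_one_or a with rfl | rfl <;> simp [spin]

/-- The pair exchange `(σ, η) ↦ (φ, α)` where `α` is `η` on `A` and `σ` off `A`, and `φ` is obtained
from `η` by the flips that turn it into `σ` on `A`. -/
def cutExchange [DecidableEq V] (A : Finset V) (t : V → V) (p : (V → ℤˣ) × (V → ℤˣ)) :
    (V → ℤˣ) × (V → ℤˣ) :=
  (fun x => p.1 (t x) * p.2 (t x) * p.2 x, A.piecewise p.2 p.1)

/-- The hybrid shows `η` on `A` and `σ` off `A`. The companion equals `σ` on `A`; the sign at `t x ∈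
A` is then known, and undoing it recovers `η` off `A`. -/
theorem cutExchange_bijective [Fintype V] [DecidableEq V] {G : SimpleGraph V} {A : Finset V}
    {t : V → V} (ht : IsCutRetraction G A t) : Function.Bijective (cutExchange A t) := by
  rw [← Finite.injective_iff_bijective]
  rintro ⟨σ, η⟩ ⟨σ', η'⟩ h
  simp only [cutExchange, Prod.mk.injEq] at h
  obtain ⟨h1, h2⟩ := h
  have hη : ∀ x ∈ A, η x = η' x := fun x hx => by simpa [hx] using congrFun h2 x
  have hσ : ∀ x, x ∉ A → σ x = σ' x := fun x hx => by simpa [hx] using congrFun h2 x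
  have hσ' : ∀ x ∈ A, σ x = σ' x := fun x hx => by
    have := congrFun h1 x
    simpa [ht.map_eq x hx, mul_assoc, Int.units_mul_self] using this
  have hη' : ∀ x, x ∉ A → η x = η' x := fun x hx => by
    have := congrFun h1 x
    simpa [hσ' _ (ht.map_mem x), hη _ (ht.map_mem x)] using this
  rw [Prod.mk.injEq]
  exact ⟨funext fun x => if hx : x ∈ A then hσ' x hx else hσ x hx,
    funext fun x => if hx : x ∈ A then hη x hx else hη' x hx⟩

variable [Fintype V] [DecidableEq V] (G : SimpleGraph V) [DecidableRel G.Adj]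
  {L : Type*} [LinearOrder L]

/-- Edge by edge: inside `A` and outside `A` the two spin products are preserved or interchanged. On
a cut edge the companion keeps the product of `η`, because `t` agrees at both ends, and only the
hybrid can lose a factor, at most `exp (2β)`. -/
theorem isingWeight_mul_isingWeight_le {β : ℝ} (hβ : 0 ≤ β) (I : V → L) (v : V) {t : V → V}
    (ht : IsCutRetraction G (initialSegment I v) t) (p : (V → ℤˣ) × (V → ℤˣ)) :
    isingWeight G β p.1 * isingWeight G β p.2 ≤
      Real.exp (2 * β * vertexWidth G I v) *
        (isingWeight G β (cutExchange (initialSegment I v) t p).1 *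
          isingWeight G β (cutExchange (initialSegment I v) t p).2) := by
  obtain ⟨σ, η⟩ := p
  set A := initialSegment I v with hA
  set C : Finset (Sym2 V) := ((Finset.univ : Finset (V × V)).filter
    fun p => I p.1 ≤ I v ∧ I v < I p.2 ∧ G.Adj p.1 p.2).image fun p => s(p.1, p.2) with hC
  have hcross : ∏ e ∈ G.edgeFinset, (if e ∈ C then Real.exp (2 * β) else 1) ≤
      Real.exp (2 * β * vertexWidth G I v) := by
    rw [Finset.prod_ite, Finset.prod_const_one, mul_one, Finset.prod_const, ← Real.exp_nat_mul]
    apply Real.exp_le_exp.2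
    have h1 : (G.edgeFinset.filter (· ∈ C)).card ≤ vertexWidth G I v :=
      (Finset.card_le_card fun e he => (Finset.mem_filter.1 he).2).trans Finset.card_image_le
    have h2 : ((G.edgeFinset.filter (· ∈ C)).card : ℝ) ≤ vertexWidth G I v := by exact_mod_cast h1
    rw [mul_comm]
    exact mul_le_mul_of_nonneg_left h2 (by positivity)
  refine le_trans ?_ (mul_le_mul_of_nonneg_right hcross ?_)
  · simp only [isingWeight, ← Finset.prod_mul_distrib]
    refine Finset.prod_le_prod (fun e _ => by positivity) fun e he => ?_
    have hedge : ∀ x y, G.Adj x y → y ∉ A →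
        Real.exp (β * spin (σ x * σ y)) * Real.exp (β * spin (η x * η y)) ≤
        (if s(x, y) ∈ C then Real.exp (2 * β) else 1) *
          (Real.exp (β * spin ((cutExchange A t (σ, η)).1 x * (cutExchange A t (σ, η)).1 y)) *
            Real.exp (β * spin ((cutExchange A t (σ, η)).2 x *
              (cutExchange A t (σ, η)).2 y))) := by
      intro x y hxy hy
      have hφ : (cutExchange A t (σ, η)).1 x * (cutExchange A t (σ, η)).1 y = η x * η y := by
        simp only [cutExchange, ht.map_adj x y hxy hy]
        rw [mul_mul_mul_comm, Int.units_mul_self, one_mul]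
      rw [hφ]
      by_cases hx : x ∈ A
      · have hmem : s(x, y) ∈ C := by
          rw [hC, Finset.mem_image]
          refine ⟨(x, y), ?_, rfl⟩
          rw [hA, mem_initialSegment] at hx hy
          simpa [hxy, hx] using hy
        rw [if_pos hmem, ← Real.exp_add, ← Real.exp_add, ← Real.exp_add]
        apply Real.exp_le_exp.2
        have h1 := le_abs_self (spin (σ x * σ y))
        have h2 := neg_abs_le (spin ((cutExchange A t (σ, η)).2 x * (cutExchange A t (σ, η)).2 y))
        rw [abs_spin] at h1 h2
        nlinarith
      · have hα : (cutExchange A t (σ, η)).2 x * (cutExchange A t (σ, η)).2 y = σ x * σ y := by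
          simp [cutExchange, hx, hy]
        rw [hα, mul_comm (Real.exp _)]
        refine le_mul_of_one_le_left (by positivity) ?_
        split_ifs
        · exact Real.one_le_exp (by positivity)
        · exact le_rfl
    rw [SimpleGraph.mem_edgeFinset] at he
    induction e with
    | h x y =>
      have hxy : G.Adj x y := he
      simp only [Sym2.map_mk, Sym2.mul_mk]
      by_cases hy : y ∈ A
      · by_cases hx : x ∈ A
        · have hx' : (cutExchange A t (σ, η)).1 x = σ x := by
            simp [cutExchange, ht.map_eq x hx, mul_assoc, Int.units_mul_self]
          have hy' : (cutExchange A t (σ, η)).1 y = σ y := by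
            simp [cutExchange, ht.map_eq y hy, mul_assoc, Int.units_mul_self]
          have hα : (cutExchange A t (σ, η)).2 x * (cutExchange A t (σ, η)).2 y = η x * η y := by
            simp [cutExchange, hx, hy]
          rw [hx', hy', hα]
          refine le_mul_of_one_le_left (by positivity) ?_
          split_ifs
          · exact Real.one_le_exp (by positivity)
          · exact le_rfl
        · have := hedge y x hxy.symm hx
          simpa only [mul_comm (σ y), mul_comm (η y), Sym2.eq_swap (a := y),
            mul_comm ((cutExchange A t (σ, η)).1 y),
            mul_comm ((cutExchange A t (σ, η)).2 y)] using this
      · exact hedge x y hxy hy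
  · exact mul_nonneg (Finset.prod_nonneg fun _ _ => (Real.exp_pos _).le)
      (Finset.prod_nonneg fun _ _ => (Real.exp_pos _).le)

omit [DecidableEq V] in
theorem isingWeight_pos (β : ℝ) (σ : V → ℤˣ) : 0 < isingWeight G β σ :=
  Finset.prod_pos fun _ _ => Real.exp_pos _

theorem sum_isingWeight_pos (β : ℝ) : 0 < ∑ σ : V → ℤˣ, isingWeight G β σ :=
  Finset.sum_pos (fun σ _ => isingWeight_pos G β σ) Finset.univ_nonempty

theorem isingMeasure_pos (β : ℝ) (σ : V → ℤˣ) : 0 < isingMeasure G β σ :=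
  div_pos (isingWeight_pos G β σ) (sum_isingWeight_pos G β)

theorem sum_isingMeasure (β : ℝ) : ∑ σ : V → ℤˣ, isingMeasure G β σ = 1 := by
  simp only [isingMeasure, ← Finset.sum_div]
  exact div_self (sum_isingWeight_pos G β).ne'

/-- If `σ` and `η` are independent samples, then the density of the configuration that is `η` up to
`v` and `σ` after `v` is at most `exp (2 β ξ(v))`. -/
theorem sum_sum_piecewise_le {β : ℝ} (hβ : 0 ≤ β) (I : V → L) (v : V) {t : V → V}
    (ht : IsCutRetraction G (initialSegment I v) t) {F : (V → ℤˣ) → ℝ} (hF : ∀ σ, 0 ≤ F σ) :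
    ∑ σ, ∑ η, isingMeasure G β σ * isingMeasure G β η *
        F ((initialSegment I v).piecewise η σ) ≤
      Real.exp (2 * β * vertexWidth G I v) * ∑ σ, isingMeasure G β σ * F σ := by
  have hZ := sum_isingWeight_pos G β
  calc _ = ∑ p : (V → ℤˣ) × (V → ℤˣ), isingMeasure G β p.1 * isingMeasure G β p.2 *
          F (cutExchange (initialSegment I v) t p).2 := by
        rw [Fintype.sum_prod_type]
        rfl
    _ ≤ ∑ p : (V → ℤˣ) × (V → ℤˣ), Real.exp (2 * β * vertexWidth G I v) *
          (isingMeasure G β (cutExchange (initialSegment I v) t p).1 *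
            isingMeasure G β (cutExchange (initialSegment I v) t p).2 *
              F (cutExchange (initialSegment I v) t p).2) := by
        refine Finset.sum_le_sum fun p _ => ?_
        rw [← mul_assoc]
        refine mul_le_mul_of_nonneg_right ?_ (hF _)
        simp only [isingMeasure]
        rw [div_mul_div_comm, div_mul_div_comm, ← mul_div_assoc]
        exact div_le_div_of_nonneg_right (isingWeight_mul_isingWeight_le G hβ I v ht p)
          (by positivity)
    _ = ∑ p : (V → ℤˣ) × (V → ℤˣ), Real.exp (2 * β * vertexWidth G I v) *
          (isingMeasure G β p.1 * isingMeasure G β p.2 * F p.2) :=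
        (cutExchange_bijective ht).sum_comp fun p => Real.exp (2 * β * vertexWidth G I v) *
          (isingMeasure G β p.1 * isingMeasure G β p.2 * F p.2)
    -- The companion configuration is summed out with total mass one.
    _ = _ := by
        rw [← Finset.mul_sum, Fintype.sum_prod_type]
        simp only [mul_assoc, ← Finset.mul_sum]
        rw [← Finset.sum_mul, sum_isingMeasure, one_mul]

end Cut

/-! ### The Poincaré inequality for the Glauber dynamics -/

section Glauber

variable {V : Type*} [Fintype V] [DecidableEq V] (G : SimpleGraph V) [DecidableRel G.Adj]
  {L : Type*} [LinearOrder L]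

omit [DecidableEq V] in
theorem localWeight_pos (β : ℝ) (σ : V → ℤˣ) (v : V) (a : ℤˣ) : 0 < localWeight G β σ v a :=
  Finset.prod_pos fun _ _ => Real.exp_pos _

omit [DecidableEq V] in
theorem sum_localWeight_pos (β : ℝ) (σ : V → ℤˣ) (v : V) : 0 < ∑ a, localWeight G β σ v a :=
  Finset.sum_pos (fun a _ => localWeight_pos G β σ v a) Finset.univ_nonempty

omit [DecidableEq V] in
theorem sum_updateProb (β : ℝ) (σ : V → ℤˣ) (v : V) : ∑ a, updateProb G β σ v a = 1 := by
  simp only [updateProb, ← Finset.sum_div]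
  exact div_self (sum_localWeight_pos G β σ v).ne'

omit [DecidableEq V] in
theorem updateProb_nonneg (β : ℝ) (σ : V → ℤˣ) (v : V) (a : ℤˣ) : 0 ≤ updateProb G β σ v a :=
  div_nonneg (localWeight_pos G β σ v a).le (sum_localWeight_pos G β σ v).le

omit [DecidableEq V] in
theorem localWeight_le {β : ℝ} (hβ : 0 ≤ β) {D : ℕ} (σ : V → ℤˣ) (v : V) (hD : G.degree v ≤ D)
    (a : ℤˣ) : localWeight G β σ v a ≤ Real.exp (β * D) := by
  have h : localWeight G β σ v a ≤ ∏ _w ∈ G.neighborFinset v, Real.exp β := by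
    refine Finset.prod_le_prod (fun _ _ => (Real.exp_pos _).le) fun w _ => ?_
    apply Real.exp_le_exp.2
    rw [← spin_mul]
    have := le_abs_self (spin (a * σ w))
    rw [abs_spin] at this
    nlinarith
  rw [Finset.prod_const, SimpleGraph.card_neighborFinset_eq_degree, ← Real.exp_nat_mul] at h
  refine h.trans (Real.exp_le_exp.2 ?_)
  rw [mul_comm]
  exact mul_le_mul_of_nonneg_left (by exact_mod_cast hD) hβ

omit [DecidableEq V] in
theorem le_localWeight {β : ℝ} (hβ : 0 ≤ β) {D : ℕ} (σ : V → ℤˣ) (v : V) (hD : G.degree v ≤ D)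
    (a : ℤˣ) : Real.exp (-(β * D)) ≤ localWeight G β σ v a := by
  have h : ∏ _w ∈ G.neighborFinset v, Real.exp (-β) ≤ localWeight G β σ v a := by
    refine Finset.prod_le_prod (fun _ _ => (Real.exp_pos _).le) fun w _ => ?_
    apply Real.exp_le_exp.2
    rw [← spin_mul]
    have := neg_abs_le (spin (a * σ w))
    rw [abs_spin] at this
    nlinarith
  rw [Finset.prod_const, SimpleGraph.card_neighborFinset_eq_degree, ← Real.exp_nat_mul] at h
  refine (Real.exp_le_exp.2 ?_).trans h
  have : (G.degree v : ℝ) ≤ D := by exact_mod_cast hD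
  nlinarith

omit [DecidableEq V] in
theorem le_updateProb {β : ℝ} (hβ : 0 ≤ β) {D : ℕ} (σ : V → ℤˣ) (v : V) (hD : G.degree v ≤ D)
    (a : ℤˣ) : (2 * Real.exp (2 * β * D))⁻¹ ≤ updateProb G β σ v a := by
  rw [updateProb, le_div_iff₀ (sum_localWeight_pos G β σ v)]
  have h1 : ∑ a, localWeight G β σ v a ≤ 2 * Real.exp (β * D) := by
    refine (Finset.sum_le_sum fun a _ => localWeight_le G hβ σ v hD a).trans ?_
    simp
  refine (mul_le_mul_of_nonneg_left h1 (by positivity)).trans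
    (le_trans (le_of_eq ?_) (le_localWeight G hβ σ v hD a))
  rw [Real.exp_neg, show 2 * β * D = β * D + β * D by ring, Real.exp_add]
  have := Real.exp_pos (β * D)
  field_simp

theorem sum_glauber_mul (β : ℝ) (ρ : V → ℝ) (σ : V → ℤˣ) (F : (V → ℤˣ) → ℝ) :
    ∑ σ', glauber G β ρ σ σ' * F σ' =
      ∑ v, ρ v * ∑ a, updateProb G β σ v a * F (Function.update σ v a) := by
  simp only [glauber, Matrix.of_apply, Finset.sum_mul]
  rw [Finset.sum_comm]
  refine Finset.sum_congr rfl fun v _ => ?_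
  rw [Finset.sum_comm, Finset.mul_sum]
  refine Finset.sum_congr rfl fun a _ => ?_
  simp only [ite_mul, zero_mul, Finset.sum_ite_eq', Finset.mem_univ, if_true]
  ring

theorem sum_glauber (β : ℝ) {ρ : V → ℝ} (hρ : ∑ v, ρ v = 1) (σ : V → ℤˣ) :
    ∑ σ', glauber G β ρ σ σ' = 1 := by
  have h := sum_glauber_mul G β ρ σ fun _ => 1
  simpa only [mul_one, sum_updateProb, hρ] using h

/-- The Dirichlet form dominates the squared gradient. -/
theorem sum_sq_flipDiff_le {β : ℝ} (hβ : 0 ≤ β) {D : ℕ} (hD : ∀ v, G.degree v ≤ D)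
    {ρ : V → ℝ} (hρ : ∀ v, 0 ≤ ρ v) (f : (V → ℤˣ) → ℝ) :
    ∑ v, ρ v * ∑ σ, isingMeasure G β σ * flipDiff f v σ ^ 2 ≤
      2 * Real.exp (2 * β * D) *
        ∑ σ, isingMeasure G β σ * ∑ σ', glauber G β ρ σ σ' * (f σ - f σ') ^ 2 := by
  have h : ∀ σ v, flipDiff f v σ ^ 2 ≤ 2 * Real.exp (2 * β * D) *
      ∑ a, updateProb G β σ v a * (f σ - f (Function.update σ v a)) ^ 2 := by
    intro σ v
    -- Only the update to the opposite spin is kept.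
    have h1 := Finset.single_le_sum (f := fun a => updateProb G β σ v a *
      (f σ - f (Function.update σ v a)) ^ 2) (fun a _ => mul_nonneg
        (updateProb_nonneg G β σ v a) (sq_nonneg _)) (Finset.mem_univ (-σ v))
    have h2 := mul_le_mul_of_nonneg_right (le_updateProb G hβ σ v (hD v) (-σ v))
      (sq_nonneg (f σ - f (Function.update σ v (-σ v))))
    rw [← sq_flipDiff_eq, inv_mul_le_iff₀ (by positivity), sq_flipDiff_eq] at h2
    rw [sq_flipDiff_eq]
    exact h2.trans (mul_le_mul_of_nonneg_left h1 (by positivity))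
  simp only [sum_glauber_mul, Finset.mul_sum]
  rw [Finset.sum_comm]
  refine Finset.sum_le_sum fun σ _ => Finset.sum_le_sum fun v _ => ?_
  have := mul_le_mul_of_nonneg_left (h σ v) (mul_nonneg (hρ v) (isingMeasure_pos G β σ).le)
  calc _ = ρ v * isingMeasure G β σ * flipDiff f v σ ^ 2 := by ring
    _ ≤ _ := this
    _ = _ := by
      simp only [Finset.mul_sum]
      exact Finset.sum_congr rfl fun a _ => by ring

/-- The Poincaré inequality obtained from an ordering with small cuts. -/
theorem glauber_poincare {β : ℝ} (hβ : 0 ≤ β) {D : ℕ} (hD : ∀ v, G.degree v ≤ D)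
    {I : V → L} (hI : Function.Injective I)
    (ht : ∀ v, ∃ t, IsCutRetraction G (initialSegment I v) t)
    {ρ : V → ℝ} (hρ : ∀ v, 0 < ρ v) (hsum : ∑ v, ρ v = 1)
    {f : (V → ℤˣ) → ℝ} (hf : ∑ σ, isingMeasure G β σ * f σ = 0) :
    ∑ σ, isingMeasure G β σ * f σ ^ 2 ≤
      (2 * Real.exp (2 * β * D) * ∑ v, Real.exp (2 * β * vertexWidth G I v) / ρ v) *
        ∑ σ, isingMeasure G β σ * (f σ * (f σ - ∑ σ', glauber G β ρ σ σ' * f σ')) := by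
  have hπ := isingMeasure_pos G β
  rw [sum_mul_sq_eq_half_sum_sq (sum_isingMeasure G β) hf,
    sum_mul_sub_eq_half_sum_sq (isingMeasure_mul_glauber G β ρ) (sum_glauber G β hsum)]
  -- Chosen so that the density bound divided by `w v` is exactly `ρ v`, the weight of `v` in the
  -- Dirichlet form.
  set w : V → ℝ := fun v => Real.exp (2 * β * vertexWidth G I v) / ρ v with hw
  have hwpos : ∀ v, 0 < w v := fun v => div_pos (Real.exp_pos _) (hρ v)
  have hW : 0 ≤ ∑ v, w v := Finset.sum_nonneg fun v _ => (hwpos v).le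
  have main : ∑ σ, ∑ η, isingMeasure G β σ * isingMeasure G β η * (f η - f σ) ^ 2 ≤
      (∑ v, w v) * ∑ v, ρ v * ∑ σ, isingMeasure G β σ * flipDiff f v σ ^ 2 := by
    calc _ ≤ ∑ σ, ∑ η, isingMeasure G β σ * isingMeasure G β η * ((∑ v, w v) *
          ∑ v, flipDiff f v ((initialSegment I v).piecewise η σ) ^ 2 / w v) :=
          Finset.sum_le_sum fun σ _ => Finset.sum_le_sum fun η _ =>
            mul_le_mul_of_nonneg_left (sq_sub_le_sum_mul_sum hI f hwpos σ η)
              (mul_nonneg (hπ σ).le (hπ η).le)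
      _ = (∑ v, w v) * ∑ v, (w v)⁻¹ * ∑ σ, ∑ η, isingMeasure G β σ * isingMeasure G β η *
          flipDiff f v ((initialSegment I v).piecewise η σ) ^ 2 := by
          simp only [Finset.mul_sum]
          symm
          refine Finset.sum_comm.trans (Finset.sum_congr rfl fun σ _ => ?_)
          refine Finset.sum_comm.trans (Finset.sum_congr rfl fun η _ => ?_)
          exact Finset.sum_congr rfl fun v _ => by ring
      _ ≤ _ := by
          refine mul_le_mul_of_nonneg_left (Finset.sum_le_sum fun v _ => ?_) hW
          obtain ⟨t, ht⟩ := ht v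
          have := sum_sum_piecewise_le G hβ I v ht (F := fun σ => flipDiff f v σ ^ 2)
            fun σ => sq_nonneg _
          refine (mul_le_mul_of_nonneg_left this (inv_nonneg.2 (hwpos v).le)).trans_eq ?_
          simp only [hw]
          have := Real.exp_pos (2 * β * vertexWidth G I v)
          have := hρ v
          field_simp
  have h2 := mul_le_mul_of_nonneg_left
    (sum_sq_flipDiff_le G hβ hD (fun v => (hρ v).le) f) hW
  linarith

/-- The relaxation time of the Glauber dynamics is controlled by the widths of an ordering. -/
theorem relaxationTime_glauber_le [Nonempty V] {β : ℝ} (hβ : 0 ≤ β) {D : ℕ}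
    (hD : ∀ v, G.degree v ≤ D) {I : V → L} (hI : Function.Injective I)
    (ht : ∀ v, ∃ t, IsCutRetraction G (initialSegment I v) t)
    {ρ : V → ℝ} (hρ : ∀ v, 0 < ρ v) (hsum : ∑ v, ρ v = 1) :
    relaxationTime (glauber G β ρ) ≤ ENNReal.ofReal
      (2 * Real.exp (2 * β * D) * ∑ v, Real.exp (2 * β * vertexWidth G I v) / ρ v) := by
  have hpos : 0 < ∑ v, Real.exp (2 * β * vertexWidth G I v) / ρ v :=
    Finset.sum_pos (fun v _ => div_pos (Real.exp_pos _) (hρ v)) Finset.univ_nonempty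
  refine relaxationTime_le_of_secondEigenvalue_le (by positivity) ?_
  have : Nontrivial ℤˣ := ⟨1, -1, by decide⟩
  refine secondEigenvalue_le_of_poincare (isingMeasure_pos G β)
    (isingMeasure_mul_glauber G β ρ) fun f hf => ?_
  rw [inv_mul_le_iff₀ (by positivity)]
  exact glauber_poincare G hβ hD hI ht hρ hsum hf

end Glauber

/-! ### Depth-first search on the complete tree -/

section Words

variable {α : Type*}

/-- The longest prefix of `l` that satisfies `p`. -/
def longestPrefix (p : List α → Prop) [DecidablePred p] (l : List α) : List α :=
  (l.inits.filter p).getLastD []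

theorem longestPrefix_append_singleton (p : List α → Prop) [DecidablePred p] (l : List α) (a : α) :
    longestPrefix p (l ++ [a]) = if p (l ++ [a]) then l ++ [a] else longestPrefix p l := by
  have h : (l ++ [a]).inits = l.inits ++ [l ++ [a]] := by simp [List.inits_append]
  rw [longestPrefix, h, List.filter_append]
  split_ifs with hp
  · simp [hp]
  · simp [hp, longestPrefix]

theorem longestPrefix_eq_self (p : List α → Prop) [DecidablePred p] {l : List α} (h : p l) :
    longestPrefix p l = l := by
  induction l using List.reverseRecOn with
  | nil => simp [longestPrefix, h]
  | append_singleton l a _ => rw [longestPrefix_append_singleton, if_pos h]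

theorem longestPrefix_spec (p : List α → Prop) [DecidablePred p] (h : p []) (l : List α) :
    p (longestPrefix p l) ∧ (longestPrefix p l).length ≤ l.length := by
  induction l using List.reverseRecOn with
  | nil => simp [longestPrefix, h]
  | append_singleton l a ih =>
    rw [longestPrefix_append_singleton]
    split_ifs with hp
    · exact ⟨hp, le_rfl⟩
    · exact ⟨ih.1, ih.2.trans (by simp)⟩

variable [LinearOrder α]

theorem lt_append_singleton (x : List α) (a : α) : x < x ++ [a] := by
  induction x with
  | nil => exact List.nil_lt_cons _ _
  | cons h x ih => exact List.cons_lt_cons_iff.2 (Or.inr ⟨rfl, ih⟩)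

/-- The words `v` between a word and one of its one-letter extensions. -/
theorem le_and_lt_append_singleton_iff {x v : List α} {a : α} :
    (x ≤ v ∧ v < x ++ [a]) ↔ v = x ∨ ∃ c < a, ∃ u, v = x ++ c :: u := by
  induction x generalizing v with
  | nil =>
    cases v with
    | nil => simp
    | cons k v => simp [List.cons_lt_cons_iff, ← not_lt]
  | cons h x ih =>
    cases v with
    | nil => simp
    | cons k v =>
      have := @ih v
      simp only [List.cons_append, ← not_lt, List.cons_lt_cons_iff, List.cons.injEq] at this ⊢
      constructor
      · rintro ⟨h1, h2 | ⟨rfl, h2⟩⟩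
        · exact absurd (Or.inl h2) h1
        · rcases this.1 ⟨fun h => h1 (Or.inr ⟨rfl, h⟩), h2⟩ with rfl | ⟨c, hc, u, rfl⟩
          · exact Or.inl ⟨rfl, rfl⟩
          · exact Or.inr ⟨c, hc, u, rfl, rfl⟩
      · intro h'
        obtain ⟨rfl, h1⟩ : k = h ∧ (v = x ∨ ∃ c < a, ∃ u, v = x ++ c :: u) := by
          rcases h' with ⟨rfl, h1⟩ | ⟨c, hc, u, rfl, h1⟩
          · exact ⟨rfl, Or.inl h1⟩
          · exact ⟨rfl, Or.inr ⟨c, hc, u, h1⟩⟩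
        have h2 := this.2 h1
        exact ⟨fun h => h.elim (lt_irrefl _) fun h => h2.1 h.2, Or.inr ⟨rfl, h2.2⟩⟩

variable [LocallyFiniteOrderTop α]

/-- The pairs of a proper prefix of `v` and a one-letter extension of it that comes after `v`. -/
def branchPairs : List α → Finset (List α × List α)
  | [] => ∅
  | k :: v => (Finset.Ioi k).image (fun a => ([], [a])) ∪
      (branchPairs v).image fun p => (k :: p.1, k :: p.2)

theorem mem_branchPairs {v x y : List α} :
    (x, y) ∈ branchPairs v ↔ ∃ a, y = x ++ [a] ∧ ∃ c < a, ∃ u, v = x ++ c :: u := by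
  induction v generalizing x y with
  | nil => simp [branchPairs]
  | cons k v ih =>
    simp only [branchPairs, Finset.mem_union, Finset.mem_image, Finset.mem_Ioi, Prod.mk.injEq,
      Prod.exists, ih]
    constructor
    · rintro (⟨a, ha, rfl, rfl⟩ | ⟨x, y, ⟨a, rfl, c, hc, u, rfl⟩, rfl, rfl⟩)
      · exact ⟨a, rfl, k, ha, v, rfl⟩
      · exact ⟨a, rfl, c, hc, u, rfl⟩
    · rintro ⟨a, rfl, c, hc, u, h⟩
      cases x with
      | nil =>
        simp only [List.nil_append, List.cons.injEq] at h
        exact Or.inl ⟨a, h.1 ▸ hc, rfl, rfl⟩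
      | cons k' x =>
        simp only [List.cons_append, List.cons.injEq] at h
        obtain ⟨rfl, rfl⟩ := h
        exact Or.inr ⟨x, x ++ [a], ⟨a, rfl, c, hc, u, rfl⟩, rfl, rfl⟩

theorem card_branchPairs (v : List α) :
    (branchPairs v).card = (v.map fun k => (Finset.Ioi k).card).sum := by
  induction v with
  | nil => rfl
  | cons k v ih =>
    rw [branchPairs, Finset.card_union_of_disjoint, Finset.card_image_of_injective,
      Finset.card_image_of_injective, ih, List.map_cons, List.sum_cons]
    · rintro ⟨x, y⟩ ⟨x', y'⟩ h
      simpa using h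
    · intro a a' h
      simpa using h
    · rw [Finset.disjoint_left]
      rintro p hp hp'
      obtain ⟨a, _, rfl⟩ := Finset.mem_image.1 hp
      obtain ⟨q, _, hq⟩ := Finset.mem_image.1 hp'
      simp at hq

end Words

/-! ### Cut edges of the depth-first order and the generating function of the widths -/

section Tree

variable {b r : ℕ}

instance : Nonempty (TreeVertex b r) := ⟨⟨[], by simp⟩⟩

theorem dfsOrder_injective : Function.Injective (dfsOrder b r) := Subtype.val_injective

/-- Each word is sent to its longest prefix that is at most `v`. Extending a word increases it, so
initial segments are closed under prefixes, and a letter leading outside the segment does not change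
this prefix. -/
theorem exists_isCutRetraction_dfsOrder (v : TreeVertex b r) :
    ∃ t, IsCutRetraction (completeTree b r) (initialSegment (dfsOrder b r) v) t := by
  set p : List (Fin b) → Prop := fun l => l ≤ v.1 with hp
  have hnil : p [] := not_lt.1 (List.not_lt_nil _)
  refine ⟨fun x => ⟨longestPrefix p x.1, (longestPrefix_spec p hnil x.1).2.trans x.2⟩,
    fun x => mem_initialSegment.2 (longestPrefix_spec p hnil x.1).1,
    fun x hx => Subtype.ext (longestPrefix_eq_self p (mem_initialSegment.1 hx)),
    fun x y hxy hy => Subtype.ext ?_⟩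
  have hy' : ¬ p y.1 := fun h => hy (mem_initialSegment.2 h)
  rcases hxy with ⟨a, h⟩ | ⟨a, h⟩
  · simp only [h] at hy' ⊢
    rw [longestPrefix_append_singleton, if_neg hy']
  · have hx' : ¬ p (y.1 ++ [a]) := fun h => hy' ((lt_append_singleton y.1 a).le.trans h)
    simp only [h]
    rw [longestPrefix_append_singleton, if_neg hx']

theorem degree_completeTree_le (v : TreeVertex b r) : (completeTree b r).degree v ≤ b + 1 := by
  rw [← SimpleGraph.card_neighborFinset_eq_degree,
    ← Finset.card_image_of_injective _ Subtype.val_injective]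
  refine (Finset.card_le_card (t := insert v.1.dropLast
    ((Finset.univ : Finset (Fin b)).image fun a => v.1 ++ [a])) ?_).trans ?_
  · intro l hl
    obtain ⟨w, hw, rfl⟩ := Finset.mem_image.1 hl
    rw [SimpleGraph.mem_neighborFinset] at hw
    rcases hw with ⟨a, h⟩ | ⟨a, h⟩
    · exact Finset.mem_insert_of_mem (Finset.mem_image.2 ⟨a, Finset.mem_univ _, h.symm⟩)
    · rw [h]
      simp
  · refine (Finset.card_insert_le _ _).trans (Nat.succ_le_succ ?_)
    exact Finset.card_image_le.trans (by simp)

/-- The number of edges from a proper prefix of `v` to a vertex after `v` in the depth-first search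
order. -/
def branchCount (v : List (Fin b)) : ℕ := (v.map fun k => (Finset.Ioi k).card).sum

/-- The edges counted by the width of `v`, as pairs of words. -/
def cutWords (v : TreeVertex b r) : Finset (List (Fin b) × List (Fin b)) :=
  ((Finset.univ : Finset (TreeVertex b r × TreeVertex b r)).filter
    fun p => dfsOrder b r p.1 ≤ dfsOrder b r v ∧ dfsOrder b r v < dfsOrder b r p.2 ∧
      (completeTree b r).Adj p.1 p.2).image (Prod.map Subtype.val Subtype.val)

theorem mem_cutWords {v : TreeVertex b r} {x y : List (Fin b)} :
    (x, y) ∈ cutWords v ↔ y.length ≤ r ∧ ∃ a, y = x ++ [a] ∧ x ≤ v.1 ∧ v.1 < y := by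
  simp only [cutWords, Finset.mem_image, Finset.mem_filter, Finset.mem_univ, true_and, Prod.map_apply,
    Prod.mk.injEq, Prod.exists]
  constructor
  · rintro ⟨x, y, ⟨h1, h2, ⟨a, h⟩ | ⟨a, h⟩⟩, rfl, rfl⟩
    · exact ⟨y.2, a, h, h1, h2⟩
    -- A child comes after its parent, so no edge crosses the cut upwards.
    · exact absurd ((h ▸ lt_append_singleton y.1 a).trans_le h1) h2.not_gt
  · rintro ⟨hy, a, rfl, h1, h2⟩
    refine ⟨⟨x, ?_⟩, ⟨x ++ [a], hy⟩, ⟨h1, h2, Or.inl ⟨a, rfl⟩⟩, rfl, rfl⟩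
    simp only [List.length_append] at hy
    omega

theorem card_cutWords (v : TreeVertex b r) :
    (cutWords v).card = vertexWidth (completeTree b r) (dfsOrder b r) v := by
  rw [cutWords, Finset.card_image_of_injective _
    (Prod.map_injective.2 ⟨Subtype.val_injective, Subtype.val_injective⟩), vertexWidth]
  congr!

/-- A later sibling of a vertex on the path to `v` has length at most that of `v`, so it does lie in
the tree. -/
theorem branchCount_le_vertexWidth (v : TreeVertex b r) :
    branchCount v.1 ≤ vertexWidth (completeTree b r) (dfsOrder b r) v := by
  rw [branchCount, ← card_branchPairs, ← card_cutWords]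
  refine Finset.card_le_card fun p hp => ?_
  obtain ⟨x, y⟩ := p
  obtain ⟨a, rfl, h⟩ := mem_branchPairs.1 hp
  refine mem_cutWords.2 ⟨?_, a, rfl, le_and_lt_append_singleton_iff.2 (Or.inr h)⟩
  obtain ⟨c, _, u, h⟩ := h
  have := v.2
  rw [h] at this
  simp only [List.length_append, List.length_cons, List.length_nil] at this ⊢
  omega

/-- Apart from the branch pairs, only the at most `b` edges from `v` to its children cross the cut.
-/
theorem vertexWidth_le (v : TreeVertex b r) :
    vertexWidth (completeTree b r) (dfsOrder b r) v ≤ branchCount v.1 + b := by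
  rw [branchCount, ← card_branchPairs, ← card_cutWords]
  refine (Finset.card_le_card (t := branchPairs v.1 ∪
    (Finset.univ : Finset (Fin b)).image fun a => (v.1, v.1 ++ [a])) ?_).trans ?_
  · rintro ⟨x, y⟩ hp
    obtain ⟨-, a, rfl, h⟩ := mem_cutWords.1 hp
    rcases le_and_lt_append_singleton_iff.1 h with h | h
    · exact Finset.mem_union_right _ (Finset.mem_image.2 ⟨a, Finset.mem_univ _, by rw [h]⟩)
    · exact Finset.mem_union_left _ (mem_branchPairs.2 ⟨a, rfl, h⟩)
  · refine (Finset.card_union_le _ _).trans (Nat.add_le_add_left ?_ _)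
    exact Finset.card_image_le.trans (by simp)

theorem branchCount_le (v : TreeVertex b r) : branchCount v.1 ≤ (b - 1) * r := by
  have h : ∀ l : List (Fin b), branchCount l ≤ (b - 1) * l.length := by
    intro l
    induction l with
    | nil => simp [branchCount]
    | cons k l ih =>
      simp only [branchCount, List.map_cons, List.sum_cons, List.length_cons, Fin.card_Ioi] at ih ⊢
      rw [Nat.mul_succ]
      omega
  exact (h v.1).trans (Nat.mul_le_mul_left _ v.2)

/-- Multiplicative functions of the words sum up to a geometric series. -/
theorem sum_treeVertex_prod (f : Fin b → ℝ) :
    ∑ v : TreeVertex b r, (v.1.map f).prod = ∑ l ∈ Finset.range (r + 1), (∑ a, f a) ^ l := by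
  rw [Finset.sum_range]
  simp only [Fintype.sum_pow]
  rw [← Fintype.sum_sigma']
  symm
  refine Fintype.sum_bijective
    (fun p : (Σ l : Fin (r + 1), (Fin l → Fin b)) =>
      (⟨List.ofFn p.2, by simpa using Nat.le_of_lt_succ p.1.2⟩ : TreeVertex b r))
    ⟨?_, ?_⟩ _ _ ?_
  · rintro ⟨⟨l, hl⟩, w⟩ ⟨⟨l', hl'⟩, w'⟩ h
    have h1 := List.ofFn_inj'.1 (congrArg Subtype.val h)
    simp only [Sigma.mk.injEq] at h1
    obtain ⟨rfl, h2⟩ := h1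
    rw [eq_of_heq h2]
  · rintro ⟨v, hv⟩
    exact ⟨⟨⟨v.length, Nat.lt_succ_of_le hv⟩, v.get⟩, Subtype.ext (List.ofFn_get v)⟩
  · rintro ⟨l, w⟩
    simp [List.map_ofFn, List.prod_ofFn]

/-- The summand is multiplicative over letters: the letter `k` has `b - 1 - k` later siblings. -/
theorem sum_pow_branchCount (q : ℝ) :
    ∑ v : TreeVertex b r, q ^ branchCount v.1 =
      ∑ l ∈ Finset.range (r + 1), (∑ j ∈ Finset.range b, q ^ j) ^ l := by
  have h1 : ∀ v : List (Fin b), q ^ branchCount v = (v.map fun k : Fin b => q ^ (b - 1 - (k : ℕ))).prod := by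
    intro v
    induction v with
    | nil => simp [branchCount]
    | cons k v ih =>
      rw [List.map_cons, List.prod_cons, ← ih, ← pow_add]
      simp [branchCount, Fin.card_Ioi]
  have h2 : ∑ k : Fin b, q ^ (b - 1 - (k : ℕ)) = ∑ j ∈ Finset.range b, q ^ j := by
    rw [Fin.sum_univ_eq_sum_range (fun j => q ^ (b - 1 - j)), Finset.sum_range_reflect]
  simp only [h1]
  rw [sum_treeVertex_prod, h2]

theorem pow_le_treeCard : (b : ℝ) ^ r ≤ treeCard b r := by
  have h := sum_treeVertex_prod (b := b) (r := r) fun _ => 1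
  simp only [List.map_const', List.prod_replicate, one_pow, Finset.sum_const, Finset.card_univ,
    nsmul_eq_mul, mul_one, Fintype.card_fin] at h
  rw [treeCard, h]
  exact Finset.single_le_sum (f := fun l => (b : ℝ) ^ l) (fun l _ => by positivity)
    (Finset.self_mem_range_succ r)

end Tree

/-! ### Relaxation times on the complete tree -/

section Bounds

/-- The induction closes because `4 + M ≤ 4 * M` exactly when `4 / 3 ≤ M`. -/
theorem sum_range_pow_le {M : ℝ} (hM : 4 / 3 ≤ M) (r : ℕ) :
    ∑ l ∈ Finset.range (r + 1), M ^ l ≤ 4 * M ^ r := by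
  induction r with
  | zero => norm_num
  | succ r ih =>
    rw [Finset.sum_range_succ]
    have : 0 ≤ M ^ r := by positivity
    rw [pow_succ]
    nlinarith

theorem sum_range_pow_le_inv {q : ℝ} (hq0 : 0 ≤ q) (hq1 : q < 1) (b : ℕ) :
    ∑ j ∈ Finset.range b, q ^ j ≤ (1 - q)⁻¹ :=
  (Summable.sum_le_tsum _ (fun j _ => pow_nonneg hq0 j)
    (summable_geometric_of_lt_one hq0 hq1)).trans_eq (tsum_geometric_of_lt_one hq0 hq1)

theorem sum_range_pow_le_mul_inv {x : ℝ} (hx : 1 < x) {b : ℕ} (hb : 1 ≤ b) :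
    ∑ j ∈ Finset.range b, x ^ j ≤ x ^ (b - 1) * (1 - x⁻¹)⁻¹ := by
  have hx0 : 0 < x := by linarith
  calc ∑ j ∈ Finset.range b, x ^ j = x ^ (b - 1) * ∑ j ∈ Finset.range b, x⁻¹ ^ j := by
        rw [← Finset.sum_range_reflect, Finset.mul_sum]
        refine Finset.sum_congr rfl fun j hj => ?_
        have hj' : b - 1 = (b - 1 - j) + j := by
          have := Finset.mem_range.1 hj
          omega
        nth_rewrite 2 [hj']
        rw [pow_add, inv_pow, mul_assoc, mul_inv_cancel₀ (by positivity), mul_one]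
    _ ≤ _ := mul_le_mul_of_nonneg_left
        (sum_range_pow_le_inv (by positivity) (inv_lt_one_of_one_lt₀ hx) b) (by positivity)

theorem sum_pow_branchCount_le {q M : ℝ} (hq : 0 ≤ q) {b : ℕ}
    (hM : ∑ j ∈ Finset.range b, q ^ j ≤ M) (hM' : 4 / 3 ≤ M) (r : ℕ) :
    ∑ v : TreeVertex b r, q ^ branchCount v.1 ≤ 4 * M ^ r := by
  rw [sum_pow_branchCount]
  refine le_trans (Finset.sum_le_sum fun l _ => ?_) (sum_range_pow_le hM' r)
  exact pow_le_pow_left₀ (Finset.sum_nonneg fun j _ => pow_nonneg hq j) hM l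

variable {b r : ℕ}

theorem vertexWidth_dfsOrder_le (hb : 1 ≤ b) (v : TreeVertex b r) :
    (vertexWidth (completeTree b r) (dfsOrder b r) v : ℝ) ≤ ((b : ℝ) - 1) * r + b := by
  have h : vertexWidth (completeTree b r) (dfsOrder b r) v ≤ (b - 1) * r + b :=
    (vertexWidth_le v).trans (Nat.add_le_add_right (branchCount_le v) b)
  have h' : (vertexWidth (completeTree b r) (dfsOrder b r) v : ℝ) ≤ ((b - 1 : ℕ) : ℝ) * r + b := by
    exact_mod_cast h
  rwa [Nat.cast_sub hb, Nat.cast_one] at h'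

/-- From `log 2 ≤ β` come `x ≥ 16` and `y ≤ 1 / 4`, so the geometric sums over one letter are at
most `x ^ (b - 1) * (16 / 15)` and `4 / 3`. -/
theorem sum_exp_vertexWidth_mul_le (hb : 2 ≤ b) {β : ℝ} (hβ : Real.log 2 ≤ β) :
    (∑ v : TreeVertex b r, Real.exp (4 * β * vertexWidth (completeTree b r) (dfsOrder b r) v)) *
      ∑ v : TreeVertex b r,
        Real.exp (-(2 * β * vertexWidth (completeTree b r) (dfsOrder b r) v)) ≤
      16 * Real.exp (4 * β * b) *
        (treeCard b r * Real.exp (4 * ((b : ℝ) - 1) * β * r)) := by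
  have hβ0 : 0 < β := (Real.log_pos (by norm_num)).trans_le hβ
  set x := Real.exp (4 * β) with hx
  set y := Real.exp (-(2 * β)) with hy
  have hx16 : 16 ≤ x := by
    have : Real.log 16 ≤ 4 * β := by
      rw [show (16 : ℝ) = 2 ^ 4 by norm_num, Real.log_pow]
      push_cast
      linarith
    exact (Real.log_le_iff_le_exp (by norm_num)).1 this
  have hy4 : y ≤ 1 / 4 := by
    have : 4 ≤ Real.exp (2 * β) := by
      rw [← Real.log_le_iff_le_exp (by norm_num), show (4 : ℝ) = 2 ^ 2 by norm_num, Real.log_pow]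
      push_cast
      linarith
    rw [hy, Real.exp_neg, one_div]
    exact inv_anti₀ (by norm_num) this
  have hy0 : 0 < y := Real.exp_pos _
  have hZ : ∑ v : TreeVertex b r,
      Real.exp (4 * β * vertexWidth (completeTree b r) (dfsOrder b r) v) ≤
      Real.exp (4 * β * b) * (4 * (x ^ (b - 1) * (16 / 15)) ^ r) := by
    have h1 : ∑ j ∈ Finset.range b, x ^ j ≤ x ^ (b - 1) * (16 / 15) := by
      refine (sum_range_pow_le_mul_inv (by linarith) (by omega)).trans
        (mul_le_mul_of_nonneg_left ?_ (by positivity))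
      have : x⁻¹ ≤ 16⁻¹ := inv_anti₀ (by norm_num) hx16
      rw [inv_le_comm₀ (by linarith) (by norm_num)]
      linarith
    have h2 : 4 / 3 ≤ x ^ (b - 1) * (16 / 15) := by
      have : x ≤ x ^ (b - 1) := le_self_pow₀ (by linarith) (by omega)
      linarith
    refine le_trans ?_ (mul_le_mul_of_nonneg_left
      (sum_pow_branchCount_le (by positivity) h1 h2 r) (Real.exp_pos _).le)
    rw [Finset.mul_sum]
    refine Finset.sum_le_sum fun v _ => ?_
    rw [hx, ← Real.exp_nat_mul, ← Real.exp_add]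
    apply Real.exp_le_exp.2
    have : (vertexWidth (completeTree b r) (dfsOrder b r) v : ℝ) ≤ branchCount v.1 + b := by
      exact_mod_cast vertexWidth_le v
    nlinarith
  have hW : ∑ v : TreeVertex b r,
      Real.exp (-(2 * β * vertexWidth (completeTree b r) (dfsOrder b r) v)) ≤
      4 * (4 / 3) ^ r := by
    have h1 : ∑ j ∈ Finset.range b, y ^ j ≤ 4 / 3 := by
      refine (sum_range_pow_le_inv hy0.le (by linarith) b).trans ?_
      rw [inv_le_comm₀ (by linarith) (by norm_num)]
      linarith
    refine le_trans (Finset.sum_le_sum fun v _ => ?_) (sum_pow_branchCount_le hy0.le h1 le_rfl r)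
    rw [hy, ← Real.exp_nat_mul]
    apply Real.exp_le_exp.2
    have : (branchCount v.1 : ℝ) ≤ vertexWidth (completeTree b r) (dfsOrder b r) v := by
      exact_mod_cast branchCount_le_vertexWidth v
    nlinarith
  refine (mul_le_mul hZ hW (Finset.sum_nonneg fun _ _ => (Real.exp_pos _).le)
    (by positivity)).trans ?_
  have hxr : (x ^ (b - 1)) ^ r = Real.exp (4 * ((b : ℝ) - 1) * β * r) := by
    rw [hx, ← pow_mul, ← Real.exp_nat_mul, Nat.cast_mul, Nat.cast_sub (by omega)]
    congr 1
    push_cast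
    ring
  -- The excess per level is `16 / 15 * (4 / 3) = 64 / 45 < 2 ≤ b`, so the number of leaves absorbs
  -- it.
  have hn : (64 / 45 : ℝ) ^ r ≤ treeCard b r := by
    refine le_trans (pow_le_pow_left₀ (by norm_num) ?_ r) pow_le_treeCard
    have : (2 : ℝ) ≤ b := by exact_mod_cast hb
    linarith
  calc _ = 16 * Real.exp (4 * β * b) * ((64 / 45) ^ r * (x ^ (b - 1)) ^ r) := by
        rw [mul_pow, show (64 / 45 : ℝ) = 16 / 15 * (4 / 3) by norm_num, mul_pow (16 / 15 : ℝ)]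
        ring
    _ ≤ _ := by
        rw [hxr]
        gcongr

theorem widthBound_pos {V : Type*} [Fintype V] [DecidableEq V] [Nonempty V] (G : SimpleGraph V)
    [DecidableRel G.Adj] {L : Type*} [LinearOrder L] (β : ℝ) (I : V → L) (v : V) :
    0 < widthBound G β I v := by
  have : 0 < Fintype.card V := Fintype.card_pos
  unfold widthBound
  positivity

theorem sum_widthBound_pos {V : Type*} [Fintype V] [DecidableEq V] [Nonempty V] (G : SimpleGraph V)
    [DecidableRel G.Adj] {L : Type*} [LinearOrder L] (β : ℝ) (I : V → L) :
    0 < ∑ v, widthBound G β I v :=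
  Finset.sum_pos (fun v _ => widthBound_pos G β I v) Finset.univ_nonempty

theorem widthRates_pos {V : Type*} [Fintype V] [DecidableEq V] [Nonempty V] (G : SimpleGraph V)
    [DecidableRel G.Adj] {L : Type*} [LinearOrder L] (β : ℝ) (I : V → L) (v : V) :
    0 < widthRates G β I v :=
  div_pos (widthBound_pos G β I v) (sum_widthBound_pos G β I)

theorem sum_widthRates {V : Type*} [Fintype V] [DecidableEq V] [Nonempty V] (G : SimpleGraph V)
    [DecidableRel G.Adj] {L : Type*} [LinearOrder L] (β : ℝ) (I : V → L) :
    ∑ v, widthRates G β I v = 1 := by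
  simp only [widthRates, ← Finset.sum_div]
  exact div_self (sum_widthBound_pos G β I).ne'

/-- The factor `|V|² exp (2Δβ)` is common to all `B_v` and cancels in the normalization. -/
theorem sum_exp_div_widthRates {V : Type*} [Fintype V] [DecidableEq V] [Nonempty V]
    (G : SimpleGraph V) [DecidableRel G.Adj] {L : Type*} [LinearOrder L] (β : ℝ) (I : V → L) :
    ∑ v, Real.exp (2 * β * vertexWidth G I v) / widthRates G β I v =
      (∑ v, Real.exp (4 * β * vertexWidth G I v)) *
        ∑ v, Real.exp (-(2 * β * vertexWidth G I v)) := by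
  have hc : (0 : ℝ) < Fintype.card V := by exact_mod_cast Fintype.card_pos (α := V)
  set c : ℝ := (Fintype.card V : ℝ) ^ 2 * Real.exp (2 * G.maxDegree * β) with hcdef
  have hc0 : 0 < c := by positivity
  have h : ∀ v, widthBound G β I v = c * Real.exp (4 * β * vertexWidth G I v) := fun v => by
    rw [widthBound, hcdef, mul_assoc, ← Real.exp_add]
    congr 2
    ring
  rw [Finset.mul_sum]
  refine Finset.sum_congr rfl fun v _ => ?_
  have hZ := sum_widthBound_pos G β I
  simp only [widthRates, h, ← Finset.mul_sum] at hZ ⊢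
  have hZ' : 0 < ∑ v, Real.exp (4 * β * vertexWidth G I v) := pos_of_mul_pos_right hZ hc0.le
  rw [mul_div_mul_left _ _ hc0.ne', div_div_eq_mul_div, Real.exp_neg,
    show 4 * β * (vertexWidth G I v : ℝ) =
      2 * β * vertexWidth G I v + 2 * β * vertexWidth G I v by ring, Real.exp_add]
  have := Real.exp_pos (2 * β * vertexWidth G I v)
  field_simp

theorem dfsRates_mem_stdSimplex (β : ℝ) : dfsRates b r β ∈ stdSimplex ℝ (TreeVertex b r) :=
  ⟨fun v => (widthRates_pos _ β _ v).le, sum_widthRates _ β _⟩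

theorem relaxationTime_dfsRates_le (hb : 2 ≤ b) {β : ℝ} (hβ : Real.log 2 ≤ β) :
    relaxationTime (glauber (completeTree b r) β (dfsRates b r β)) ≤ ENNReal.ofReal
      (32 * Real.exp (2 * β * (b + 1)) * Real.exp (4 * β * b) *
        (treeCard b r * Real.exp (4 * ((b : ℝ) - 1) * β * r))) := by
  have hβ0 : 0 < β := (Real.log_pos (by norm_num)).trans_le hβ
  refine (relaxationTime_glauber_le (completeTree b r) hβ0.le degree_completeTree_le
    dfsOrder_injective exists_isCutRetraction_dfsOrder (widthRates_pos _ β _)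
    (sum_widthRates _ β _)).trans (ENNReal.ofReal_le_ofReal ?_)
  rw [sum_exp_div_widthRates]
  refine (mul_le_mul_of_nonneg_left (sum_exp_vertexWidth_mul_le hb hβ)
    (by positivity)).trans_eq ?_
  push_cast
  ring

theorem relaxationTime_uniformRates_le (hb : 2 ≤ b) {β : ℝ} (hβ : 0 < β) :
    relaxationTime (glauber (completeTree b r) β (uniformRates (TreeVertex b r))) ≤
      ENNReal.ofReal (2 * Real.exp (2 * β * (b + 1)) * Real.exp (2 * β * b) *
        ((treeCard b r : ℝ) ^ 2 * Real.exp (4 * ((b : ℝ) - 1) * β * r))) := by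
  have hn : (0 : ℝ) < Fintype.card (TreeVertex b r) := by exact_mod_cast Fintype.card_pos
  refine (relaxationTime_glauber_le (completeTree b r) hβ.le degree_completeTree_le
    dfsOrder_injective exists_isCutRetraction_dfsOrder (fun v => one_div_pos.2 hn) ?_).trans
    (ENNReal.ofReal_le_ofReal ?_)
  · simp only [Finset.sum_const, Finset.card_univ, nsmul_eq_mul]
    exact mul_one_div_cancel hn.ne'
  have hb1 : (2 : ℝ) ≤ b := by exact_mod_cast hb
  have h : ∑ v : TreeVertex b r,
      Real.exp (2 * β * vertexWidth (completeTree b r) (dfsOrder b r) v) /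
        uniformRates (TreeVertex b r) v ≤
      ∑ _v : TreeVertex b r, Real.exp (2 * β * b) * Real.exp (4 * ((b : ℝ) - 1) * β * r) *
        Fintype.card (TreeVertex b r) := by
    refine Finset.sum_le_sum fun v _ => ?_
    rw [uniformRates, div_div_eq_mul_div, div_one, ← Real.exp_add]
    refine mul_le_mul_of_nonneg_right (Real.exp_le_exp.2 ?_) hn.le
    have h1 := mul_le_mul_of_nonneg_left (vertexWidth_dfsOrder_le (r := r) (by omega) v)
      (by positivity : 0 ≤ 2 * β)
    -- The argument gives the exponent `2(b-1)βr`; this nonnegativity relaxes it to `4(b-1)βr`.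
    have h2 : 0 ≤ ((b : ℝ) - 1) * r * β :=
      mul_nonneg (mul_nonneg (by linarith) (Nat.cast_nonneg r)) hβ.le
    linarith
  refine (mul_le_mul_of_nonneg_left h (by positivity)).trans_eq ?_
  rw [Finset.sum_const, Finset.card_univ, nsmul_eq_mul, treeCard]
  push_cast
  ring

end Bounds

end

theorem proposition5 (b : ℕ) (hb : 2 ≤ b) :
    (∃ β₀ : ℝ, 0 < β₀ ∧ ∀ β : ℝ, β₀ ≤ β → ∃ C : ℝ, 0 < C ∧ ∀ r : ℕ,
      dfsRates b r β ∈ stdSimplex ℝ (TreeVertex b r) ∧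
      relaxationTime (glauber (completeTree b r) β (dfsRates b r β)) ≤
        ENNReal.ofReal
          (C * ((treeCard b r : ℝ) * Real.exp (4 * ((b : ℝ) - 1) * β * (r : ℝ)))) ∧
      ∀ ρ : TreeVertex b r → ℝ, IsOptimalRates (completeTree b r) β ρ →
        relaxationTime (glauber (completeTree b r) β ρ) ≤
          ENNReal.ofReal
            (C * ((treeCard b r : ℝ) * Real.exp (4 * ((b : ℝ) - 1) * β * (r : ℝ))))) ∧
    (∀ β : ℝ, 0 < β → ∃ C : ℝ, 0 < C ∧ ∀ r : ℕ,
      relaxationTime (glauber (completeTree b r) β (uniformRates (TreeVertex b r))) ≤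
        ENNReal.ofReal
          (C * ((treeCard b r : ℝ) ^ 2 * Real.exp (4 * ((b : ℝ) - 1) * β * (r : ℝ))))) := by

  refine ⟨⟨Real.log 2, Real.log_pos (by norm_num), fun β hβ => ⟨32 * Real.exp (2 * β * (b + 1)) *
    Real.exp (4 * β * b), by positivity, fun r => ⟨dfsRates_mem_stdSimplex β,
      relaxationTime_dfsRates_le hb hβ, fun ρ hρ => ?_⟩⟩⟩, fun β hβ =>
    ⟨2 * Real.exp (2 * β * (b + 1)) * Real.exp (2 * β * b), by positivity, fun r =>
      relaxationTime_uniformRates_le hb hβ⟩⟩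
  -- A minimizer does at least as well as the depth-first rates.
  exact (hρ.2 _ (dfsRates_mem_stdSimplex β)).trans (relaxationTime_dfsRates_le hb hβ)
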